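/- Let $S\subset\mathbb C^2$ be the curve $(y^3+x^2)(y^3-x^2)=0$ and, for $x\in\mathbb C$, let $K(x)=\{y : (x,y)\in S\}$; then $K(x)$ has six points for every $x\neq 0$, so the origin is the only point of $N=\{x : |K(x)|<6\}$. Let $r>0$, let $E$ be the closed disc of radius $r$ about $0$, and take $M=r\in\partial E$ as base point. The braid monodromy $\varphi:\pi_1(E\setminus N,M)\to B_6$ sends the class of a loop $\gamma$ to the braid traced out in the $y$-plane by the six points of $K(\gamma(t))$, $t\in[0,1]$; here $B_6$ is the group of motions (up to homotopy) of unordered configurations of six distinct points of $\mathbb C$ that start and end at $K(M)$. To express braids in Artin generators, the braid is rotated clockwise by a small angle $\theta$, that is, all points of the $y$-plane are multiplied by $e^{-i\theta}$; for $0<\theta<\pi/6$ the points of $e^{-i\theta}K(M)$ have distinct real parts. Number them $1,\dots,6$ by increasing real part and let $\sigma_i$ ($1\le i\le 5$) be the positive (counterclockwise) half-twist along the straight segment joining the points $i$ and $i+1$. Products of braids are read from left to right, the leftmost factor being performed first. Then for every such $r$ and every $0<\theta<\pi/6$ the local braid monodromy of $S$ at the origin is generated by the braid $(\sigma_2\sigma_4\sigma_1\sigma_3\sigma_5)^4$: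 the loop $\Gamma(t)=re^{2\pi i t}$ is sent by $\varphi$, after the rotation, to $$(\sigma_2\sigma_4\sigma_1\sigma_3\sigma_5)^4\in B_6,$$ and the image of $\varphi$ (after the rotation) is the cyclic group generated by this element. -/

import Mathlib

open Polynomial Set Topology
open scoped unitInterval

/-! ### Loops, composed in the order in which they are travelled -/

/-- The fundamental group of `X` at `x`, with the usual multiplication of loops:
in `a * b` the loop `a` is travelled first and `b` second. (Mathlib's `FundamentalGroup` multiplies
in the opposite order, whence the `ᵐᵒᵖ`.) -/
abbrev LoopGroup (X : Type*) [TopologicalSpace X] (x : X) : Type _ :=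
  (FundamentalGroup X x)ᵐᵒᵖ

/-- The class of a loop. -/
def loopClass {X : Type*} [TopologicalSpace X] {x : X} (γ : Path x x) : LoopGroup X x :=
  MulOpposite.op (FundamentalGroup.fromPath (Path.Homotopic.Quotient.mk γ))

/-- In a product of loop classes the left factor is travelled first. -/
theorem loopClass_mul {X : Type*} [TopologicalSpace X] {x : X} (γ δ : Path x x) :
    loopClass γ * loopClass δ = loopClass (γ.trans δ) := rfl

/-- The homomorphism induced by a continuous map. -/
noncomputable def loopMap {X Y : Type*} [TopologicalSpace X] [TopologicalSpace Y] (g : C(X, Y)) (x : X) :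
    LoopGroup X x →* LoopGroup Y (g x) :=
  MonoidHom.op (FundamentalGroup.map g x)

/-! ### Configuration spaces and the braid group -/

/-- Ordered configurations of `n` distinct points of the plane. -/
abbrev OrdConf (n : ℕ) : Type := {p : Fin n → ℂ // Function.Injective p}

/-- Two ordered configurations are identified when they have the same underlying set of points,
that is, when they differ by a permutation of the labels. -/
instance confSetoid (n : ℕ) : Setoid (OrdConf n) where
  r p q := range p.1 = range q.1
  iseqv := ⟨fun _ => rfl, fun h => h.symm, fun h k => h.trans k⟩

/-- Unordered configurations of `n` distinct points of the plane (with the quotient topology). -/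
def UConf (n : ℕ) : Type := Quotient (confSetoid n)

instance (n : ℕ) : TopologicalSpace (UConf n) :=
  inferInstanceAs (TopologicalSpace (Quotient (confSetoid n)))

namespace UConf

/-- The unordered configuration underlying an ordered one. -/
def mk {n : ℕ} (p : OrdConf n) : UConf n := Quotient.mk _ p

theorem continuous_mk {n : ℕ} : Continuous (mk : OrdConf n → UConf n) := continuous_quotient_mk'

/-- The set of points of a configuration. -/
def points {n : ℕ} (c : UConf n) : Set ℂ :=
  Quotient.lift (fun p : OrdConf n => range p.1) (fun _ _ h => h) c

@[simp] theorem points_mk {n : ℕ} (p : OrdConf n) : (mk p).points = range p.1 := rfl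

theorem points_injective {n : ℕ} : Function.Injective (points : UConf n → Set ℂ) := by
  intro c d
  refine Quotient.inductionOn₂ c d fun p q h => Quotient.sound ?_
  exact h

theorem exists_mk {n : ℕ} (c : UConf n) : ∃ p : OrdConf n, mk p = c := Quotient.exists_rep c

end UConf

/-- The (geometric) braid group on `n` strings, based at the configuration `c`: classes of motions
of `n` distinct points of the plane that start and end at `c`. -/
abbrev BraidGroup {n : ℕ} (c : UConf n) : Type := LoopGroup (UConf n) c

/-- The clockwise rotation of the plane through the angle `θ`, acting on configurations. -/
noncomputable def rotateClockwise (n : ℕ) (θ : ℝ) : C(UConf n, UConf n) where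
  toFun := Quotient.map
    (fun p : OrdConf n => (⟨fun i => Complex.exp (-(θ * Complex.I)) * p.1 i, fun _ _ h =>
      p.2 (mul_left_cancel₀ (Complex.exp_ne_zero _) h)⟩ : OrdConf n))
    (fun p q (h : range p.1 = range q.1) => by
      change range ((fun z => Complex.exp (-(θ * Complex.I)) * z) ∘ p.1)
        = range ((fun z => Complex.exp (-(θ * Complex.I)) * z) ∘ q.1)
      rw [range_comp, range_comp, h])
  continuous_toFun := by
    refine Continuous.quotient_map' (s := confSetoid n) (t := confSetoid n) ?_ _
    refine Continuous.subtype_mk (continuous_pi fun i => ?_) _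
    exact continuous_const.mul ((continuous_apply i).comp continuous_subtype_val)

theorem rotateClockwise_points (n : ℕ) (θ : ℝ) (c : UConf n) :
    (rotateClockwise n θ c).points = (fun z => Complex.exp (-(θ * Complex.I)) * z) '' c.points := by
  refine Quotient.inductionOn c fun p => ?_
  exact range_comp (fun z => Complex.exp (-(θ * Complex.I)) * z) p.1

/-! ### Half-twists and Artin generators -/

/-- The motion that exchanges the consecutive points `p i` and `p (i + 1)`, all the other points
being at rest: the left one moves to the right passing below, the right one moves to the left
passing above, so the exchange is counterclockwise. -/
noncomputable def twistMotion {n : ℕ} (p : Fin (n + 1) → ℂ) (i : Fin n) (t : ℝ) :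
    Fin (n + 1) → ℂ := fun j =>
  if j = i.castSucc then
    p i.castSucc + t * (p i.succ - p i.castSucc) - Real.sin (Real.pi * t) * Complex.I
  else if j = i.succ then
    p i.succ - t * (p i.succ - p i.castSucc) + Real.sin (Real.pi * t) * Complex.I
  else p j

theorem twistMotion_injective {n : ℕ} {p : Fin (n + 1) → ℂ} (hp : StrictMono fun j => (p j).re)
    (i : Fin n) {t : ℝ} (h0 : 0 ≤ t) (h1 : t ≤ 1) : Function.Injective (twistMotion p i t) := by
  have hne : i.succ ≠ i.castSucc := (Fin.castSucc_lt_succ (i := i)).ne'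
  have hlt : (p i.castSucc).re < (p i.succ).re := hp (Fin.castSucc_lt_succ (i := i))
  -- the two moving points do not meet
  have hmove : twistMotion p i t i.castSucc ≠ twistMotion p i t i.succ := by
    intro h
    simp only [twistMotion, if_true, if_neg hne] at h
    generalize hs : Real.sin (Real.pi * t) = s at h
    have hre := congrArg Complex.re h
    have him := congrArg Complex.im h
    simp at hre him
    have ht : t = 1 / 2 := by
      have : ((p i.succ).re - (p i.castSucc).re) * (2 * t - 1) = 0 := by linarith
      rcases mul_eq_zero.1 this with h | h <;> linarith
    subst ht
    rw [mul_one_div, Real.sin_pi_div_two] at hs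
    linarith
  -- a moving point does not meet a point at rest
  have hrest : ∀ j, j ≠ i.castSucc → j ≠ i.succ →
      ∀ x : ℝ, (p i.castSucc).re ≤ x → x ≤ (p i.succ).re → (p j).re ≠ x := by
    intro j hj hj' x hx hx' h
    rcases lt_or_gt_of_ne hj with hl | hl
    · have := hp hl
      simp only at this
      linarith
    · have hl' : i.succ < j := lt_of_le_of_ne (Fin.castSucc_lt_iff_succ_le.1 hl) (Ne.symm hj')
      have := hp hl'
      simp only at this
      linarith
  have hA : ∀ j, j ≠ i.castSucc → j ≠ i.succ →
      twistMotion p i t j ≠ twistMotion p i t i.castSucc := by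
    intro j hj hj' h
    simp only [twistMotion, if_true, if_neg hj, if_neg hj'] at h
    generalize Real.sin (Real.pi * t) = s at h
    refine hrest j hj hj' _ ?_ ?_ (congrArg Complex.re h)
    · simp; nlinarith
    · simp; nlinarith
  have hB : ∀ j, j ≠ i.castSucc → j ≠ i.succ →
      twistMotion p i t j ≠ twistMotion p i t i.succ := by
    intro j hj hj' h
    simp only [twistMotion, if_true, if_neg hne, if_neg hj, if_neg hj'] at h
    generalize Real.sin (Real.pi * t) = s at h
    refine hrest j hj hj' _ ?_ ?_ (congrArg Complex.re h)
    · simp; nlinarith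
    · simp; nlinarith
  intro j k hjk
  by_contra hne'
  by_cases hj : j = i.castSucc
  · subst hj
    by_cases hk : k = i.succ
    · subst hk; exact hmove hjk
    · exact hA k (Ne.symm hne') hk hjk.symm
  by_cases hj' : j = i.succ
  · subst hj'
    by_cases hk : k = i.castSucc
    · subst hk; exact hmove hjk.symm
    · exact hB k hk (Ne.symm hne') hjk.symm
  by_cases hk : k = i.castSucc
  · subst hk; exact hA j hj hj' hjk
  by_cases hk' : k = i.succ
  · subst hk'; exact hB j hj hj' hjk
  simp only [twistMotion, if_neg hj, if_neg hj', if_neg hk, if_neg hk'] at hjk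
  exact hne' (hp.injective (congrArg Complex.re hjk))

/-- `p` lists the points of the configuration `c` from left to right, and these points have
pairwise distinct real parts. -/
def IsSortedListing {n : ℕ} (c : UConf n) (p : Fin n → ℂ) : Prop :=
  (StrictMono fun j => (p j).re) ∧ range p = c.points

/-- A configuration is in general position (for the projection of braids to the real axis) when
its points have distinct real parts. -/
def InGeneralPosition {n : ℕ} (c : UConf n) : Prop :=
  InjOn Complex.re c.points

theorem InGeneralPosition.exists_listing {n : ℕ} {c : UConf n} (h : InGeneralPosition c) :
    ∃ p : Fin n → ℂ, IsSortedListing c p := by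
  obtain ⟨q, rfl⟩ := UConf.exists_mk c
  have hinj : Function.Injective fun j => (q.1 j).re := fun j k hjk =>
    q.2 (h (mem_range_self j) (mem_range_self k) hjk)
  refine ⟨q.1 ∘ Tuple.sort (fun j => (q.1 j).re), ?_, ?_⟩
  · exact (Tuple.monotone_sort (fun j => (q.1 j).re)).strictMono_of_injective
      (hinj.comp (Tuple.sort _).injective)
  · rw [UConf.points_mk, (Tuple.sort _).surjective.range_comp]

/-- The left-to-right listing is unique. -/
theorem IsSortedListing.unique {n : ℕ} {c : UConf n} {p q : Fin n → ℂ}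
    (hp : IsSortedListing c p) (hq : IsSortedListing c q) : p = q := by
  have hre : (fun j => (p j).re) = fun j => (q j).re := by
    refine (StrictMono.range_inj hp.1 hq.1).1 ?_
    change range (Complex.re ∘ p) = range (Complex.re ∘ q)
    rw [range_comp, range_comp, hp.2, hq.2]
  funext j
  have hj : p j ∈ range q := by rw [hq.2, ← hp.2]; exact mem_range_self j
  obtain ⟨k, hk⟩ := hj
  have : (q k).re = (q j).re := by rw [hk]; exact congrFun hre j
  rw [← hk, hq.1.injective this]

/-- The points of a configuration in general position, listed from left to right. -/
noncomputable def sortedListing {n : ℕ} {c : UConf n} (h : InGeneralPosition c) : Fin n → ℂ :=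
  Classical.choose h.exists_listing

theorem sortedListing_spec {n : ℕ} {c : UConf n} (h : InGeneralPosition c) :
    IsSortedListing c (sortedListing h) :=
  Classical.choose_spec h.exists_listing

/-- The positive half-twist loop exchanging the points number `i` and `i + 1` (from the left) of
the configuration `c`. -/
noncomputable def halfTwist {n : ℕ} {c : UConf (n + 1)} (h : InGeneralPosition c) (i : Fin n) :
    Path c c where
  toFun t := UConf.mk ⟨twistMotion (sortedListing h) i t,
    twistMotion_injective (sortedListing_spec h).1 i t.2.1 t.2.2⟩
  continuous_toFun := by
    refine UConf.continuous_mk.comp (Continuous.subtype_mk (continuous_pi fun j => ?_) _)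
    unfold twistMotion
    split_ifs <;> fun_prop
  source' := by
    refine UConf.points_injective ?_
    refine Eq.trans ?_ (sortedListing_spec h).2
    rw [UConf.points_mk]
    congr 1
    funext j
    simp only [twistMotion]
    split_ifs with h1 h2
    · simp [h1]
    · simp [h2]
    · rfl
  target' := by
    refine UConf.points_injective ?_
    have hne : i.succ ≠ i.castSucc := (Fin.castSucc_lt_succ (i := i)).ne'
    refine Eq.trans ?_ (sortedListing_spec h).2
    refine Eq.trans ?_ ((Equiv.swap i.castSucc i.succ).surjective.range_comp (sortedListing h))
    rw [UConf.points_mk]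
    congr 1
    funext j
    simp only [twistMotion, Function.comp_apply]
    split_ifs with h1 h2
    · simp [h1, Equiv.swap_apply_left]
    · simp [h2, Equiv.swap_apply_right]
    · rw [Equiv.swap_apply_of_ne_of_ne h1 h2]

/-- The Artin generators of the braid group based at a configuration in general position:
`artinGenerator h i` exchanges the points number `i` and `i + 1`, counted from the left and
starting with `0`; so the usual `σ₁, σ₂, …` are `artinGenerator h 0, artinGenerator h 1, …`. -/
noncomputable def artinGenerator {n : ℕ} {c : UConf (n + 1)} (h : InGeneralPosition c)
    (i : Fin n) : BraidGroup c :=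
  loopClass (halfTwist h i)

/-! ### Braid monodromy of a plane curve

A plane curve is given by `f : ℂ[X][X]`; the inner variable is the first coordinate `x` and the
outer variable is the second coordinate `y`. -/

/-- `K(x)`: the second coordinates of the points of the curve above `x`. -/
def curveFiber (f : ℂ[X][X]) (x : ℂ) : Set ℂ := {y | (f.map (evalRingHom x)).eval y = 0}

/-- The set `N` of those `x` above which the curve does not have exactly `n` points; for `n` the
degree of the curve with respect to the projection to `x` this means that it has fewer than `n`
points, or contains the whole line above `x`. -/
def criticalSet (f : ℂ[X][X]) (n : ℕ) : Set ℂ := {x | (curveFiber f x).encard ≠ n}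

theorem exists_fiberConf {f : ℂ[X][X]} {n : ℕ} {x : ℂ} (hx : x ∉ criticalSet f n) :
    ∃ c : UConf n, c.points = curveFiber f x := by
  have h : (curveFiber f x).encard = n := by simpa [criticalSet] using hx
  have hfin : (curveFiber f x).Finite := finite_of_encard_eq_coe h
  have hcard : hfin.toFinset.card = n := by
    rw [hfin.encard_eq_coe_toFinset_card] at h
    exact_mod_cast h
  let e := (hfin.toFinset.equivFinOfCardEq hcard).symm
  refine ⟨UConf.mk ⟨fun i => (e i : ℂ), Subtype.val_injective.comp e.injective⟩, ?_⟩
  rw [UConf.points_mk]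
  change range (Subtype.val ∘ e) = _
  rw [e.surjective.range_comp, Subtype.range_val]
  ext; simp

/-- The configuration `K(x)`, for `x` outside of `N`. -/
noncomputable def fiberConfFun (f : ℂ[X][X]) (n : ℕ) (E : Set ℂ)
    (x : ↥(E \ criticalSet f n)) : UConf n :=
  Classical.choose (exists_fiberConf x.2.2)

theorem points_fiberConfFun (f : ℂ[X][X]) (n : ℕ) (E : Set ℂ) (x : ↥(E \ criticalSet f n)) :
    (fiberConfFun f n E x).points = curveFiber f x :=
  Classical.choose_spec (exists_fiberConf x.2.2)

/-- Above `x ∉ N` the leading coefficient does not vanish. -/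
theorem coeff_ne_zero_of_notMem {f : ℂ[X][X]} {n : ℕ} (hn : f.natDegree = n) {x : ℂ}
    (hx : x ∉ criticalSet f n) :
    (f.map (evalRingHom x)).natDegree = n ∧ (f.coeff n).eval x ≠ 0 := by
  have h : (curveFiber f x).encard = n := by simpa [criticalSet] using hx
  set g := f.map (evalRingHom x) with hg
  have hg0 : g ≠ 0 := by
    intro h0
    have : curveFiber f x = univ := by ext y; simp [curveFiber, ← hg, h0]
    rw [this, infinite_univ.encard_eq] at h
    exact ENat.top_ne_natCast n h
  have hsub : curveFiber f x = (g.roots.toFinset : Set ℂ) := by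
    ext y; simp [curveFiber, ← hg, hg0]
  rw [hsub, encard_coe_eq_coe_finsetCard] at h
  have h1 : n ≤ g.natDegree := by
    have : g.roots.toFinset.card = n := by exact_mod_cast h
    rw [← this]
    exact (Multiset.toFinset_card_le _).trans (card_roots' g)
  have h2 : g.natDegree ≤ n := hn ▸ natDegree_map_le
  have h3 : g.natDegree = n := le_antisymm h2 h1
  refine ⟨h3, ?_⟩
  have : g.coeff n ≠ 0 := by rw [← h3]; simpa using hg0
  simpa [hg, coeff_map] using this

/-- The points of the fibre depend continuously on `x`. -/
theorem continuous_fiberConfFun {f : ℂ[X][X]} {n : ℕ} (hn : f.natDegree = n) (E : Set ℂ) :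
    Continuous (fiberConfFun f n E) := by
  have hcont : ∀ y : ℂ, Continuous fun x : ℂ => (f.map (evalRingHom x)).eval y := by
    intro y
    have : (fun x : ℂ => (f.map (evalRingHom x)).eval y)
        = fun x => ∑ i ∈ Finset.range (f.natDegree + 1), (f.coeff i).eval x * y ^ i := by
      funext x
      rw [eval_map, eval₂_eq_sum_range]
      simp
    rw [this]
    fun_prop
  refine continuous_iff_continuousAt.2 fun x₀ => ?_
  intro U hU
  obtain ⟨p, hp⟩ := UConf.exists_mk (fiberConfFun f n E x₀)
  have hroot : ∀ i, (f.map (evalRingHom (x₀ : ℂ))).eval (p.1 i) = 0 := by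
    intro i
    have : p.1 i ∈ curveFiber f x₀ := by
      rw [← points_fiberConfFun f n E x₀, ← hp]
      exact mem_range_self i
    exact this
  -- a ball around `p` consisting of ordered configurations that lie over `U`
  obtain ⟨ε, hε, hball⟩ : ∃ ε > 0, ∀ q : Fin n → ℂ, (∀ i, dist (q i) (p.1 i) < ε) →
      ∃ hq : Function.Injective q, UConf.mk ⟨q, hq⟩ ∈ U := by
    have hU' : UConf.mk ⁻¹' U ∈ 𝓝 p :=
      UConf.continuous_mk.continuousAt.preimage_mem_nhds (by rwa [hp])
    rw [nhds_subtype_eq_comap, Filter.mem_comap] at hU'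
    obtain ⟨V, hV, hVU⟩ := hU'
    have hinj : {q : Fin n → ℂ | Function.Injective q} ∈ 𝓝 p.1 := by
      have : ∀ᶠ q in 𝓝 p.1, ∀ i j : Fin n, i ≠ j → q i ≠ q j := by
        refine Filter.eventually_all.2 fun i => Filter.eventually_all.2 fun j => ?_
        by_cases hij : i = j
        · exact Filter.Eventually.of_forall fun q h => (h hij).elim
        · have hopen : IsOpen {q : Fin n → ℂ | q i ≠ q j} :=
            isOpen_ne_fun (continuous_apply i) (continuous_apply j)
          exact (hopen.eventually_mem (x := p.1) fun h => hij (p.2 h)).mono fun q hq _ => hq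
      refine this.mono fun q hq i j hij => ?_
      by_contra hne
      exact hq i j hne hij
    obtain ⟨ε, hε, hsub⟩ := Metric.mem_nhds_iff.1 (Filter.inter_mem hV hinj)
    refine ⟨ε, hε, fun q hq => ?_⟩
    have hq' := hsub (Metric.mem_ball.2 ((dist_pi_lt_iff hε).2 hq))
    exact ⟨hq'.2, hVU (a := ⟨q, hq'.2⟩) hq'.1⟩
  -- near `x₀` there is a root near every `p i`
  have hnear : ∀ i, ∀ᶠ x : ↥(E \ criticalSet f n) in 𝓝 x₀,
      ‖(f.map (evalRingHom (x : ℂ))).eval (p.1 i)‖ < ‖(f.coeff n).eval (x : ℂ)‖ * ε ^ n := by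
    intro i
    refine ContinuousAt.eventually_lt ?_ ?_ ?_
    · exact ((hcont (p.1 i)).comp continuous_subtype_val).norm.continuousAt
    · exact Continuous.continuousAt (by fun_prop)
    · rw [hroot i, norm_zero]
      have := (coeff_ne_zero_of_notMem hn x₀.2.2).2
      positivity
  refine Filter.mem_map.2 (Filter.mem_of_superset (Filter.eventually_all.2 hnear) fun x hx => ?_)
  have hx' := coeff_ne_zero_of_notMem hn x.2.2
  have hex : ∀ i, ∃ b ∈ curveFiber f x, dist b (p.1 i) < ε := by
    intro i
    by_contra! hcon
    set g := f.map (evalRingHom (x : ℂ)) with hg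
    have hlead : g.leadingCoeff = (f.coeff n).eval (x : ℂ) := by
      rw [leadingCoeff, hx'.1, hg, coeff_map]; rfl
    have hsplit : g.Splits := IsAlgClosed.splits g
    have hcard : g.roots.card = n := by rw [← hx'.1, hsplit.natDegree_eq_card_roots]
    have heval : g.eval (p.1 i) = g.leadingCoeff * (g.roots.map fun b => p.1 i - b).prod :=
      hsplit.eval_eq_prod_roots (p.1 i)
    have hg0 : g ≠ 0 := by
      intro h0
      exact hx'.2 (by rw [← hlead, h0, leadingCoeff_zero])
    have hprod : ∀ s : Multiset ℂ, (∀ b ∈ s, ε ≤ dist b (p.1 i)) →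
        ε ^ s.card ≤ ‖(s.map fun b => p.1 i - b).prod‖ := by
      intro s
      induction s using Multiset.induction_on with
      | empty => intro _; simp
      | cons a s ih =>
        intro hs
        have h1 := hs a (Multiset.mem_cons_self a s)
        have h2 := ih fun b hb => hs b (Multiset.mem_cons_of_mem hb)
        rw [Multiset.map_cons, Multiset.prod_cons, norm_mul, Multiset.card_cons, pow_succ']
        rw [dist_comm, dist_eq_norm] at h1
        gcongr
    have hb := hprod g.roots fun b hb => hcon b (by
      have := (mem_roots hg0).1 hb
      exact this)
    have := hx i
    rw [hcard] at hb
    rw [heval, norm_mul, hlead] at this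
    have hpos : 0 < ‖(f.coeff n).eval (x : ℂ)‖ := norm_pos_iff.2 hx'.2
    exact absurd ((mul_lt_mul_iff_right₀ hpos).1 this) (not_lt.2 hb)
  choose b hbmem hbdist using hex
  obtain ⟨hbinj, hbU⟩ := hball b hbdist
  have heq : UConf.mk ⟨b, hbinj⟩ = fiberConfFun f n E x := by
    refine UConf.points_injective ?_
    rw [points_fiberConfFun, UConf.points_mk]
    have hsub : range b ⊆ curveFiber f x := by rintro _ ⟨i, rfl⟩; exact hbmem i
    have hcardx : (curveFiber f x).encard = n := by
      have := x.2.2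
      simpa [criticalSet] using this
    refine ((finite_of_encard_eq_coe hcardx).subset hsub).eq_of_subset_of_encard_le hsub ?_
    rw [hcardx, ← image_univ, hbinj.encard_image]
    simp
  change fiberConfFun f n E x ∈ U
  rwa [← heq]

/-- The continuous map `x ↦ K(x)` on `E \ N`, for a curve of degree `n` over the `x`-line. -/
noncomputable def fiberConf (f : ℂ[X][X]) {n : ℕ} (hn : f.natDegree = n) (E : Set ℂ) :
    C(↥(E \ criticalSet f n), UConf n) :=
  ⟨fiberConfFun f n E, continuous_fiberConfFun hn E⟩

/-- The braid monodromy over `E` with base point `M`: a loop in `E \ N` is sent to the braid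
traced out by the points of the fibres of the curve above it. -/
noncomputable def braidMonodromy (f : ℂ[X][X]) {n : ℕ} (hn : f.natDegree = n) (E : Set ℂ)
    (M : ↥(E \ criticalSet f n)) :
    LoopGroup ↥(E \ criticalSet f n) M →* BraidGroup (fiberConf f hn E M) :=
  loopMap (fiberConf f hn E) M

/-! ### Loops around a point of the base -/

/-- The point `x₀ + r` of the boundary of the disc with centre `x₀` and radius `r`, in a disc that
contains no point of `N` except possibly its centre. -/
def boundaryPoint {N : Set ℂ} {x₀ : ℂ} {r : ℝ} (hr : 0 < r)
    (h : Metric.closedBall x₀ r ∩ N ⊆ {x₀}) : ↥(Metric.closedBall x₀ r \ N) :=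
  ⟨x₀ + r, by
    have hmem : x₀ + (r : ℂ) ∈ Metric.closedBall x₀ r := by
      simp [abs_of_pos hr]
    refine ⟨hmem, fun hN => ?_⟩
    have := h ⟨hmem, hN⟩
    simp [hr.ne'] at this⟩

/-- The boundary circle of that disc, `t ↦ x₀ + r e^{2πit}`, run through once counterclockwise. -/
noncomputable def boundaryLoop {N : Set ℂ} {x₀ : ℂ} {r : ℝ} (hr : 0 < r)
    (h : Metric.closedBall x₀ r ∩ N ⊆ {x₀}) :
    Path (boundaryPoint hr h) (boundaryPoint hr h) where
  toFun t := ⟨x₀ + r * Complex.exp (2 * Real.pi * Complex.I * (t : ℝ)), by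
    have hexp : ‖Complex.exp (2 * Real.pi * Complex.I * (t : ℝ))‖ = 1 := by
      rw [Complex.norm_exp]; simp
    have hmem : x₀ + r * Complex.exp (2 * Real.pi * Complex.I * (t : ℝ))
        ∈ Metric.closedBall x₀ r := by
      simp [hexp, abs_of_pos hr]
    refine ⟨hmem, fun hN => ?_⟩
    have := h ⟨hmem, hN⟩
    simp [hr.ne'] at this⟩
  continuous_toFun := by
    refine Continuous.subtype_mk ?_ _
    fun_prop
  source' := by
    refine Subtype.ext ?_
    simp [boundaryPoint]
  target' := by
    refine Subtype.ext ?_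
    simp [boundaryPoint, Complex.exp_two_pi_mul_I]

/-! ### The curve `(y³ + x²)(y³ - x²) = 0` -/

/-- The polynomial `(y³ + x²)(y³ - x²)`. -/
noncomputable def twoCusps : ℂ[X][X] := (X ^ 3 + C (X ^ 2)) * (X ^ 3 - C (X ^ 2))

theorem twoCusps_natDegree : twoCusps.natDegree = 6 := by
  have h1 : (X ^ 3 + C (X ^ 2) : ℂ[X][X]).Monic := monic_X_pow_add_C _ (by norm_num)
  have h2 : (X ^ 3 - C (X ^ 2) : ℂ[X][X]).Monic := monic_X_pow_sub_C _ (by norm_num)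
  rw [twoCusps, h1.natDegree_mul h2, natDegree_X_pow_add_C, natDegree_X_pow_sub_C]

/-- Above every `x ≠ 0` the curve has six points. -/
theorem twoCusps_criticalSet_subset (E : Set ℂ) : E ∩ criticalSet twoCusps 6 ⊆ {0} := by
  rintro x ⟨-, hx⟩
  by_contra hx0
  have hx0 : x ≠ 0 := hx0
  refine hx ?_
  have hmap : twoCusps.map (evalRingHom x) = X ^ 6 - C (x ^ 4) := by
    simp [twoCusps]
    ring
  have hsep : (X ^ 6 - C (x ^ 4) : ℂ[X]).Separable :=
    separable_X_pow_sub_C _ (by norm_num) (pow_ne_zero _ hx0)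
  have hne : (X ^ 6 - C (x ^ 4) : ℂ[X]) ≠ 0 := X_pow_sub_C_ne_zero (by norm_num) _
  have hset : curveFiber twoCusps x = ((X ^ 6 - C (x ^ 4) : ℂ[X]).roots.toFinset : Set ℂ) := by
    ext y
    rw [curveFiber, mem_ofPred_eq, hmap, Finset.mem_coe, Multiset.mem_toFinset, mem_roots hne]
    rfl
  rw [hset, encard_coe_eq_coe_finsetCard,
    Multiset.toFinset_card_of_nodup (nodup_roots hsep),
    ← (IsAlgClosed.splits (X ^ 6 - C (x ^ 4) : ℂ[X])).natDegree_eq_card_roots,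
    natDegree_X_pow_sub_C]

/-! Since (y³ + x²)(y³ - x²) = y⁶ - x⁴, the fibre over x ≠ 0 is a regular hexagon of radius
|x|^(2/3). As x runs once around the circle, x⁴ turns through 8π, so the hexagon turns rigidly
through 8π/6 = 4 · (π/3). A turn through π/3 is already a closed motion, so the monodromy of the
boundary circle is its fourth power. It remains to write the turn through π/3 in Artin generators
(`loopClass_rotationLoop_hexagon`) and to know that the boundary circle generates the fundamental
group of the punctured disc (`zpowers_loopClass_boundaryLoop`).

Both facts use one principle, `LiftsAlong.homotopic`: paths with lifts to a simply connected space
that share their end points there are homotopic. For the punctured disc that space is the left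
half-plane, mapped by the exponential. For braids it is `starOf q`, the ordered configurations that
move straight to a fixed `q` without collision; it is star-shaped about `q`, hence contractible.

Take as `q` a hexagon turned slightly counterclockwise, labelled from left to right. Then p ∈
`starOf q` means that no difference of two points of p is a nonpositive real multiple of the
corresponding difference in `q`; for this it is enough that the real parts, or the imaginary parts,
of the two differences have the same strict sign. The rotation stays within an angle π/4 of `q`, so
it lifts. The initial hexagon is turned clockwise and zigzags oppositely to `q`: with the labels of
`q`, its neighbours 1, 2 and 3, 4 (counted from 0) are in the wrong order. The twists σ₂, σ₄ undo
these two inversions, and σ₁, σ₃, σ₅ create those of the hexagon turned by π/3. At every moment a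
pair of labels in the wrong horizontal order has the right vertical order, so the product lifts too,
with the same end points (`twistMotion_comp_mem_starOf`). -/

/-! ### Paths that lift along a map -/

/-- The path `g` is the image under `f` of a path from `a` to `b`. -/
def LiftsAlong {X Y : Type*} [TopologicalSpace X] [TopologicalSpace Y] (f : Y → X) {x x' : X}
    (g : Path x x') (a b : Y) : Prop :=
  ∃ G : Path a b, ∀ t, f (G t) = g t

namespace LiftsAlong

variable {X Y : Type*} [TopologicalSpace X] [TopologicalSpace Y] {f : Y → X} {x x' x'' : X}
  {g : Path x x'} {g' : Path x' x''} {a b c : Y}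

theorem trans (h : LiftsAlong f g a b) (h' : LiftsAlong f g' b c) :
    LiftsAlong f (g.trans g') a c := by
  obtain ⟨G, hG⟩ := h
  obtain ⟨G', hG'⟩ := h'
  refine ⟨G.trans G', fun t => ?_⟩
  rw [Path.trans_apply, Path.trans_apply]
  split_ifs
  · exact hG _
  · exact hG' _

theorem symm (h : LiftsAlong f g a b) : LiftsAlong f g.symm b a := by
  obtain ⟨G, hG⟩ := h
  exact ⟨G.symm, fun t => hG _⟩

/-- Two paths that lift to a simply connected space, with the same end points there, are
homotopic. -/
theorem homotopic [SimplyConnectedSpace Y] (hf : Continuous f) {g₁ g₂ : Path x x'}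
    (h₁ : LiftsAlong f g₁ a b) (h₂ : LiftsAlong f g₂ a b) : g₁.Homotopic g₂ := by
  obtain ⟨G₁, hG₁⟩ := h₁
  obtain ⟨G₂, hG₂⟩ := h₂
  have hx : x = f a := by rw [← g₁.source, ← hG₁, G₁.source]
  have hx' : x' = f b := by rw [← g₁.target, ← hG₁, G₁.target]
  subst hx hx'
  have e₁ : G₁.map hf = g₁ := Path.ext (funext hG₁)
  have e₂ : G₂.map hf = g₂ := Path.ext (funext hG₂)
  rw [← e₁, ← e₂]
  exact (SimplyConnectedSpace.paths_homotopic G₁ G₂).map ⟨f, hf⟩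

end LiftsAlong

theorem loopClass_eq_of_homotopic {X : Type*} [TopologicalSpace X] {x : X} {γ δ : Path x x}
    (h : γ.Homotopic δ) : loopClass γ = loopClass δ := by
  unfold loopClass
  rw [Path.Homotopic.Quotient.eq.2 h]

theorem exists_loopClass_eq {X : Type*} [TopologicalSpace X] {x : X} (a : LoopGroup X x) :
    ∃ γ : Path x x, loopClass γ = a := by
  obtain ⟨γ, hγ⟩ := Path.Homotopic.Quotient.mk_surjective (MulOpposite.unop a)
  exact ⟨γ, by unfold loopClass; rw [hγ]; rfl⟩

theorem loopClass_symm {X : Type*} [TopologicalSpace X] {x : X} (γ : Path x x) :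
    loopClass γ.symm = (loopClass γ)⁻¹ := rfl

theorem loopClass_refl {X : Type*} [TopologicalSpace X] (x : X) :
    loopClass (Path.refl x) = 1 := rfl

/-! ### The fundamental group of a punctured disc -/

/-- The closed left half-plane. -/
abbrev LeftHalfPlane : Type := {z : ℂ | z.re ≤ 0}

instance : SimplyConnectedSpace LeftHalfPlane :=
  haveI : ContractibleSpace LeftHalfPlane :=
    (convex_halfSpace_re_le 0).contractibleSpace ⟨0, by simp⟩
  inferInstance

section PuncturedDisc

variable {N : Set ℂ} {x₀ : ℂ} {r : ℝ}

/-- The exponential covering of the punctured disc by the left half-plane. -/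
noncomputable def discExp (hr : 0 < r) (h : Metric.closedBall x₀ r ∩ N ⊆ {x₀})
    (z : LeftHalfPlane) : ↥(Metric.closedBall x₀ r \ N) :=
  ⟨x₀ + r * Complex.exp z, by
    have hz : (z : ℂ).re ≤ 0 := z.2
    have hmem : x₀ + r * Complex.exp z ∈ Metric.closedBall x₀ r := by
      rw [mem_closedBall_iff_norm, add_sub_cancel_left, norm_mul, Complex.norm_exp,
        Complex.norm_real, Real.norm_of_nonneg hr.le]
      exact mul_le_of_le_one_right hr.le (Real.exp_le_one_iff.2 hz)
    refine ⟨hmem, fun hN => ?_⟩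
    have := h ⟨hmem, hN⟩
    simp [hr.ne'] at this⟩

theorem continuous_discExp (hr : 0 < r) (h : Metric.closedBall x₀ r ∩ N ⊆ {x₀}) :
    Continuous (discExp hr h) := by
  refine Continuous.subtype_mk ?_ _
  fun_prop

/-- The point `2πin` of the left half-plane. -/
noncomputable def twoPiI (n : ℤ) : LeftHalfPlane :=
  ⟨n * (2 * Real.pi * Complex.I), by simp⟩

theorem boundaryLoop_liftsAlong (hr : 0 < r) (h : Metric.closedBall x₀ r ∩ N ⊆ {x₀}) (n : ℤ) :
    LiftsAlong (discExp hr h) (boundaryLoop hr h) (twoPiI n) (twoPiI (n + 1)) := by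
  refine ⟨⟨⟨fun t => ⟨(n + (t : ℝ)) * (2 * Real.pi * Complex.I), ?_⟩, ?_⟩, ?_, ?_⟩, ?_⟩
  · simp
  · refine Continuous.subtype_mk ?_ _
    fun_prop
  · simp [twoPiI]
  · simp [twoPiI]
  · intro t
    refine Subtype.ext ?_
    change x₀ + r * Complex.exp ((n + (t : ℝ)) * (2 * Real.pi * Complex.I))
      = x₀ + r * Complex.exp (2 * Real.pi * Complex.I * (t : ℝ))
    rw [add_mul, Complex.exp_add, Complex.exp_int_mul_two_pi_mul_I, one_mul, mul_comm (t : ℂ)]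

theorem exists_liftsAlong_zpow (hr : 0 < r) (h : Metric.closedBall x₀ r ∩ N ⊆ {x₀}) (n : ℤ) :
    ∃ g : Path (boundaryPoint hr h) (boundaryPoint hr h),
      loopClass g = loopClass (boundaryLoop hr h) ^ n ∧
        LiftsAlong (discExp hr h) g (twoPiI 0) (twoPiI n) := by
  induction n using Int.induction_on with
  | zero =>
    refine ⟨Path.refl _, by rw [zpow_zero, loopClass_refl], Path.refl _, fun t => ?_⟩
    refine Subtype.ext ?_
    change x₀ + r * Complex.exp ((0 : ℤ) * (2 * Real.pi * Complex.I)) = x₀ + r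
    simp
  | succ n ih =>
    obtain ⟨g, hg, hl⟩ := ih
    exact ⟨g.trans (boundaryLoop hr h), by rw [← loopClass_mul, hg, zpow_add_one],
      hl.trans (boundaryLoop_liftsAlong hr h _)⟩
  | pred n ih =>
    obtain ⟨g, hg, hl⟩ := ih
    refine ⟨g.trans (boundaryLoop hr h).symm,
      by rw [← loopClass_mul, hg, loopClass_symm, zpow_sub_one], hl.trans ?_⟩
    have := (boundaryLoop_liftsAlong hr h (-n - 1)).symm
    rwa [sub_add_cancel] at this

/-- After recentring and rescaling, the loop avoids 0 and lifts through the covering by the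
exponential. The bound by the radius keeps the lift in the left half-plane, and closedness of the
loop puts its end point in 2πiℤ. -/
theorem exists_liftsAlong_discExp (hr : 0 < r) (h : Metric.closedBall x₀ r ∩ N ⊆ {x₀})
    (hx₀ : x₀ ∈ N) (g : Path (boundaryPoint hr h) (boundaryPoint hr h)) :
    ∃ n : ℤ, LiftsAlong (discExp hr h) g (twoPiI 0) (twoPiI n) := by
  have hrC : (r : ℂ) ≠ 0 := by exact_mod_cast hr.ne'
  have hne : ∀ t, ((g t : ℂ) - x₀) / r ≠ 0 := by
    intro t ht
    rcases div_eq_zero_iff.1 ht with ht | ht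
    · exact (g t).2.2 (by rwa [sub_eq_zero.1 ht])
    · exact hrC ht
  let γ : C(I, {z : ℂ // z ≠ 0}) :=
    ⟨fun t => ⟨((g t : ℂ) - x₀) / r, hne t⟩, by
      refine Continuous.subtype_mk ?_ _
      exact ((continuous_subtype_val.comp g.continuous).sub continuous_const).div_const _⟩
  have hγ0 : γ 0 = ⟨_, Complex.exp_ne_zero 0⟩ := by
    refine Subtype.ext ?_
    change ((g 0 : ℂ) - x₀) / r = Complex.exp 0
    rw [g.source]
    simp [boundaryPoint, hrC]
  obtain ⟨G, hG, hG0⟩ := Complex.isCoveringMap_exp.exists_path_lifts γ 0 hγ0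
  have hG' : ∀ t, Complex.exp (G t) = ((g t : ℂ) - x₀) / r := fun t =>
    congrArg Subtype.val (congrFun hG t)
  have hre : ∀ t, (G t).re ≤ 0 := by
    intro t
    rw [← Real.exp_le_one_iff, ← Complex.norm_exp, hG', norm_div, Complex.norm_real,
      Real.norm_of_nonneg hr.le, div_le_one hr]
    exact mem_closedBall_iff_norm.1 (g t).2.1
  obtain ⟨n, hn⟩ : ∃ n : ℤ, G 1 = n * (2 * Real.pi * Complex.I) := by
    refine Complex.exp_eq_one_iff.1 ?_
    rw [hG', g.target]
    simp [boundaryPoint, hrC]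
  refine ⟨n, ⟨⟨fun t => ⟨G t, hre t⟩, G.continuous.subtype_mk _⟩, ?_, ?_⟩, fun t => ?_⟩
  · exact Subtype.ext (by simp [twoPiI, hG0])
  · exact Subtype.ext hn
  · refine Subtype.ext ?_
    change x₀ + r * Complex.exp (G t) = g t
    rw [hG', mul_div_cancel₀ _ hrC, add_sub_cancel]

/-- The fundamental group of a punctured disc is generated by its boundary circle. -/
theorem zpowers_loopClass_boundaryLoop (hr : 0 < r) (h : Metric.closedBall x₀ r ∩ N ⊆ {x₀})
    (hx₀ : x₀ ∈ N) : Subgroup.zpowers (loopClass (boundaryLoop hr h)) = ⊤ := by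
  refine (Subgroup.eq_top_iff' _).2 fun a => ?_
  obtain ⟨g, rfl⟩ := exists_loopClass_eq a
  obtain ⟨n, hn⟩ := exists_liftsAlong_discExp hr h hx₀ g
  obtain ⟨g', hg', hl⟩ := exists_liftsAlong_zpow hr h n
  rw [loopClass_eq_of_homotopic (hn.homotopic (continuous_discExp hr h) hl), hg']
  exact Subgroup.zpow_mem_zpowers _ _

end PuncturedDisc

/-! ### Configurations joined to a given one by a straight motion -/

/-- The configurations `p` such that no two points meet in the straight motion from `p` to `q`. -/
def starOf {n : ℕ} (q : Fin n → ℂ) : Set (Fin n → ℂ) :=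
  {p | ∀ i j, i ≠ j → (p i - p j) / (q i - q j) ∈ Complex.slitPlane}

/-- Along the straight motion each quotient of differences moves on a segment towards 1, and the
slit plane is star-shaped about 1. -/
theorem starConvex_starOf {n : ℕ} {q : Fin n → ℂ} (hq : Function.Injective q) :
    StarConvex ℝ q (starOf q) := by
  intro p hp a b ha hb hab i j hij
  have hne : q i - q j ≠ 0 := sub_ne_zero.2 (hq.ne hij)
  have h := Complex.starConvex_one_slitPlane (hp i j hij) ha hb hab
  convert h using 1
  simp only [Pi.add_apply, Pi.smul_apply, Complex.real_smul]
  field_simp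
  ring

theorem self_mem_starOf {n : ℕ} {q : Fin n → ℂ} (hq : Function.Injective q) : q ∈ starOf q := by
  intro i j hij
  rw [div_self (sub_ne_zero.2 (hq.ne hij))]
  exact Complex.one_mem_slitPlane

theorem simplyConnectedSpace_starOf {n : ℕ} {q : Fin n → ℂ} (hq : Function.Injective q) :
    SimplyConnectedSpace (starOf q) :=
  haveI : ContractibleSpace (starOf q) :=
    (starConvex_starOf hq).contractibleSpace ⟨q, self_mem_starOf hq⟩
  inferInstance

theorem injective_of_mem_starOf {n : ℕ} {p q : Fin n → ℂ} (hp : p ∈ starOf q) :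
    Function.Injective p := by
  intro i j hij
  by_contra hne
  have := Complex.slitPlane_ne_zero (hp i j hne)
  rw [hij, sub_self, zero_div] at this
  exact this rfl

/-- The unordered configuration underlying an element of `starOf q`. -/
def starConf {n : ℕ} (q : Fin n → ℂ) (p : starOf q) : UConf n :=
  UConf.mk ⟨p, injective_of_mem_starOf p.2⟩

theorem continuous_starConf {n : ℕ} (q : Fin n → ℂ) : Continuous (starConf q) :=
  UConf.continuous_mk.comp (continuous_subtype_val.subtype_mk _)

/-- The motion `g` lifts to a motion of ordered configurations from `a` to `b`, within the
configurations that are joined to `q` by a straight motion. -/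
def StarLift {n : ℕ} (q : Fin n → ℂ) {c d : UConf n} (g : Path c d) (a b : Fin n → ℂ) : Prop :=
  ∃ (ha : a ∈ starOf q) (hb : b ∈ starOf q), LiftsAlong (starConf q) g ⟨a, ha⟩ ⟨b, hb⟩

theorem StarLift.trans {n : ℕ} {q : Fin n → ℂ} {c d e : UConf n} {g : Path c d} {g' : Path d e}
    {a b b' : Fin n → ℂ} (h : StarLift q g a b) (h' : StarLift q g' b b') :
    StarLift q (g.trans g') a b' := by
  obtain ⟨ha, _, h⟩ := h
  obtain ⟨_, hb', h'⟩ := h'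
  exact ⟨ha, hb', h.trans h'⟩

theorem StarLift.homotopic {n : ℕ} {q : Fin n → ℂ} (hq : Function.Injective q) {c d : UConf n}
    {g₁ g₂ : Path c d} {a b : Fin n → ℂ} (h₁ : StarLift q g₁ a b) (h₂ : StarLift q g₂ a b) :
    g₁.Homotopic g₂ := by
  obtain ⟨_, _, h₁⟩ := h₁
  obtain ⟨_, _, h₂⟩ := h₂
  have := simplyConnectedSpace_starOf hq
  exact h₁.homotopic (continuous_starConf q) h₂

theorem StarLift.of_forall {n : ℕ} {q : Fin n → ℂ} {c d : UConf n} {g : Path c d}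
    (G : I → Fin n → ℂ) (hG : Continuous G) (hmem : ∀ t, G t ∈ starOf q)
    (hg : ∀ t, (g t).points = range (G t)) : StarLift q g (G 0) (G 1) :=
  ⟨hmem 0, hmem 1, ⟨⟨fun t => ⟨G t, hmem t⟩, hG.subtype_mk _⟩, rfl, rfl⟩,
    fun t => UConf.points_injective (hg t).symm⟩

/-- Otherwise a = k b with k ≤ 0 real, and the real parts would not have the same strict sign. -/
theorem div_mem_slitPlane_of_re {a b : ℂ} (h : 0 < a.re * b.re) : a / b ∈ Complex.slitPlane := by
  have hb : 0 < Complex.normSq b := Complex.normSq_pos.2 (by rintro rfl; simp at h)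
  by_contra hc
  rw [Complex.mem_slitPlane_iff, not_or, not_not, not_lt] at hc
  obtain ⟨k, hk⟩ : ∃ k : ℝ, a / b = k := ⟨(a / b).re, Complex.ext rfl (by simpa using hc.2)⟩
  have ha : a = k * b := by rw [← hk, div_mul_cancel₀]; rintro rfl; simp at h
  rw [hk, Complex.ofReal_re] at hc
  rw [ha, Complex.re_ofReal_mul] at h
  nlinarith [mul_nonneg (neg_nonneg.2 hc.1) (mul_self_nonneg b.re)]

theorem div_mem_slitPlane_of_im {a b : ℂ} (h : 0 < a.im * b.im) : a / b ∈ Complex.slitPlane := by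
  have := div_mem_slitPlane_of_re (a := Complex.I * a) (b := Complex.I * b) (by simpa using h)
  rwa [mul_div_mul_left _ _ Complex.I_ne_zero] at this

theorem mem_starOf_of_lt {n : ℕ} {p q : Fin n → ℂ}
    (h : ∀ i j, i < j → (p i - p j) / (q i - q j) ∈ Complex.slitPlane) : p ∈ starOf q := by
  intro i j hij
  rcases lt_or_gt_of_ne hij with hlt | hlt
  · exact h i j hlt
  · rw [← neg_sub (p j), ← neg_sub (q j), neg_div_neg_eq]
    exact h j i hlt

/-! ### Half-twists of configurations in zigzag position -/

section Twist

variable {n : ℕ} {p : Fin (n + 1) → ℂ} {i : Fin n} {t : ℝ}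

theorem twistMotion_castSucc : twistMotion p i t i.castSucc =
    p i.castSucc + t * (p i.succ - p i.castSucc) - Real.sin (Real.pi * t) * Complex.I := by
  simp [twistMotion]

theorem twistMotion_succ : twistMotion p i t i.succ =
    p i.succ - t * (p i.succ - p i.castSucc) + Real.sin (Real.pi * t) * Complex.I := by
  have hne : i.succ ≠ i.castSucc := (Fin.castSucc_lt_succ (i := i)).ne'
  simp [twistMotion, hne]

theorem twistMotion_of_ne {j : Fin (n + 1)} (h : j ≠ i.castSucc) (h' : j ≠ i.succ) :
    twistMotion p i t j = p j := by
  simp [twistMotion, h, h']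

theorem twistMotion_zero : twistMotion p i 0 = p := by
  funext j
  simp only [twistMotion]
  split_ifs with h h' <;> simp [*]

theorem twistMotion_one : twistMotion p i 1 = p ∘ Equiv.swap i.castSucc i.succ := by
  funext j
  simp only [twistMotion, Function.comp_apply]
  split_ifs with h h'
  · simp [h]
  · simp [h']
  · rw [Equiv.swap_apply_of_ne_of_ne h h']

/-- Apart from the exchanged points, the order of the real parts is kept during a half-twist. -/
theorem re_twistMotion_lt (hp : StrictMono fun j => (p j).re) (h0 : 0 ≤ t) (h1 : t ≤ 1)
    {j k : Fin (n + 1)} (hjk : j < k) (hne : ¬(j = i.castSucc ∧ k = i.succ)) :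
    (twistMotion p i t j).re < (twistMotion p i t k).re := by
  have hlt : (p i.castSucc).re < (p i.succ).re := hp (Fin.castSucc_lt_succ (i := i))
  have hA : (twistMotion p i t i.castSucc).re
      = (p i.castSucc).re + t * ((p i.succ).re - (p i.castSucc).re) := by
    rw [twistMotion_castSucc]
    generalize Real.sin (Real.pi * t) = s
    simp
  have hB : (twistMotion p i t i.succ).re
      = (p i.succ).re - t * ((p i.succ).re - (p i.castSucc).re) := by
    rw [twistMotion_succ]
    generalize Real.sin (Real.pi * t) = s
    simp
  have hcs : (i.castSucc : Fin (n + 1)) < i.succ := Fin.castSucc_lt_succ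
  by_cases hj : j = i.castSucc
  · have hk : i.succ < k := lt_of_le_of_ne (Fin.castSucc_lt_iff_succ_le.1 (hj ▸ hjk))
      fun h => hne ⟨hj, h.symm⟩
    have := hp hk
    simp only at this
    rw [twistMotion_of_ne (hcs.trans hk).ne' hk.ne', hj, hA]
    nlinarith
  by_cases hj' : j = i.succ
  · have hk : i.succ < k := hj' ▸ hjk
    have := hp hk
    simp only at this
    rw [twistMotion_of_ne (hcs.trans hk).ne' hk.ne', hj', hB]
    nlinarith
  rw [twistMotion_of_ne hj hj']
  by_cases hk : k = i.castSucc
  · have := hp (hk ▸ hjk)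
    simp only at this
    rw [hk, hA]
    nlinarith
  by_cases hk' : k = i.succ
  · have hlt' : j < i.castSucc := by
      rw [hk', Fin.lt_def, Fin.val_succ] at hjk
      rw [Fin.ext_iff, Fin.val_castSucc] at hj
      rw [Fin.lt_def, Fin.val_castSucc]
      omega
    have := hp hlt'
    simp only at this
    rw [hk', hB]
    nlinarith
  rw [twistMotion_of_ne hk hk']
  exact hp hjk

/-- The points of `p` are listed from left to right, and lie alternately above and below; the
even-numbered ones are above their neighbours if `b = 0`, the odd-numbered ones if `b = 1`. -/
structure IsZigzag (p : Fin (n + 1) → ℂ) (b : ℕ) : Prop where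
  strictMono : StrictMono fun j => (p j).re
  im_lt : ∀ k : Fin n, (k : ℕ) % 2 = b → (p k.succ).im < (p k.castSucc).im
  lt_im : ∀ k : Fin n, (k : ℕ) % 2 ≠ b → (p k.castSucc).im < (p k.succ).im

/-- What the half-twist exchanging the positions `i` and `i + 1` does to the labels `a < b`, which
`τ` puts at the positions `τ a` and `τ b`: either it keeps `τ a` to the left of `τ b`; or it
exchanges neighbouring labels, which start in the right order if the first is even and in the wrong
order if it is odd; or the labels are neighbours in the wrong order, and both are at rest. -/
def TwistCompatible (τ : Equiv.Perm (Fin (n + 1))) (i : Fin n) (a b : Fin (n + 1)) : Prop :=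
  (τ a < τ b ∧ ¬(τ a = i.castSucc ∧ τ b = i.succ)) ∨
  ((i : ℕ) % 2 = 0 ∧ a = i.castSucc ∧ b = i.succ ∧ τ a = a ∧ τ b = b) ∨
  ((i : ℕ) % 2 = 1 ∧ a = i.castSucc ∧ b = i.succ ∧ τ a = b ∧ τ b = a) ∨
  ∃ k : Fin n, a = k.castSucc ∧ b = k.succ ∧ τ a = b ∧ τ b = a ∧
    a ≠ i.castSucc ∧ a ≠ i.succ ∧ b ≠ i.castSucc ∧ b ≠ i.succ

instance (τ : Equiv.Perm (Fin (n + 1))) (i : Fin n) (a b : Fin (n + 1)) :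
    Decidable (TwistCompatible τ i a b) := by
  unfold TwistCompatible; infer_instance

/-- The zigzags of `p` and `q` are opposite, so neighbours listed in the wrong order in `p` have the
same vertical order as in `q`. For an exchanged pair the real parts serve on one side of t = 1/2 and
the imaginary parts on the other, because the left point passes below. -/
theorem twistMotion_comp_mem_starOf {q : Fin (n + 1) → ℂ} (hp : IsZigzag p 0) (hq : IsZigzag q 1)
    {τ : Equiv.Perm (Fin (n + 1))} (hτ : ∀ a b, a < b → TwistCompatible τ i a b)
    (h0 : 0 ≤ t) (h1 : t ≤ 1) : twistMotion p i t ∘ τ ∈ starOf q := by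
  refine mem_starOf_of_lt fun a b hab => ?_
  have hqab : (q a - q b).re < 0 := by
    have := hq.strictMono hab
    simp only at this
    rw [Complex.sub_re]
    linarith
  have hi := hp.strictMono (Fin.castSucc_lt_succ (i := i))
  simp only at hi
  have hs : 0 ≤ Real.sin (Real.pi * t) :=
    Real.sin_nonneg_of_nonneg_of_le_pi (by positivity) (by nlinarith [Real.pi_pos])
  -- At t = 1/2 the exchanged points are on a vertical line with equal contributions from `p`, so
  -- only the sine term separates them; elsewhere its sign suffices.
  have hhalf : t = 1 / 2 → Real.sin (Real.pi * t) = 1 := by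
    rintro rfl
    rw [mul_one_div, Real.sin_pi_div_two]
  simp only [Function.comp_apply]
  rcases hτ a b hab with ⟨hlt, hne⟩ | ⟨hpar, ha, hb, hτa, hτb⟩ | ⟨hpar, ha, hb, hτa, hτb⟩ |
    ⟨k, ha, hb, hτa, hτb, h₁, h₂, h₃, h₄⟩
  · refine div_mem_slitPlane_of_re (mul_pos_of_neg_of_neg ?_ hqab)
    rw [Complex.sub_re, sub_neg]
    exact re_twistMotion_lt hp.strictMono h0 h1 hlt hne
  -- An inversion is created: the real parts work before t = 1/2. From then on the first label is
  -- below the second, as in `q`.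
  · rw [hτa, hτb]
    subst ha hb
    have hpi := hp.im_lt i hpar
    have hqi := hq.lt_im i (by omega)
    rw [twistMotion_castSucc, twistMotion_succ]
    generalize Real.sin (Real.pi * t) = s at hs hhalf
    rcases lt_or_ge t (1 / 2) with ht | ht
    · refine div_mem_slitPlane_of_re (mul_pos_of_neg_of_neg ?_ hqab)
      simp
      nlinarith
    · refine div_mem_slitPlane_of_im (mul_pos_of_neg_of_neg ?_ (by simpa using hqi))
      simp
      rcases ht.eq_or_lt with ht | ht
      · rw [hhalf ht.symm, ← ht]
        linarith
      · nlinarith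
  -- An inversion is undone: up to t = 1/2 the first label is above the second, as in `q`;
  -- afterwards the real parts work.
  · rw [hτa, hτb]
    subst ha hb
    have hpi := hp.lt_im i (by omega)
    have hqi := hq.im_lt i hpar
    rw [twistMotion_castSucc, twistMotion_succ]
    generalize Real.sin (Real.pi * t) = s at hs hhalf
    rcases lt_or_ge (1 / 2) t with ht | ht
    · refine div_mem_slitPlane_of_re (mul_pos_of_neg_of_neg ?_ hqab)
      simp
      nlinarith
    · refine div_mem_slitPlane_of_im (mul_pos ?_ (by simpa using hqi))
      simp
      rcases ht.eq_or_lt with ht | ht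
      · rw [hhalf ht, ht]
        linarith
      · nlinarith
  · rw [hτa, hτb, twistMotion_of_ne h₁ h₂, twistMotion_of_ne h₃ h₄]
    subst ha hb
    rcases Nat.mod_two_eq_zero_or_one k with hpar | hpar
    · have hpk := hp.im_lt k hpar
      have hqk := hq.lt_im k (by omega)
      exact div_mem_slitPlane_of_im
        (mul_pos_of_neg_of_neg (by simpa using hpk) (by simpa using hqk))
    · have hpk := hp.lt_im k (by omega)
      have hqk := hq.im_lt k hpar
      exact div_mem_slitPlane_of_im (mul_pos (by simpa using hpk) (by simpa using hqk))

/-- In `p ∘ τ` the label j sits at position τ j. The twist permutes positions, hence the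
transposition multiplies τ on the left. Compatibility is a finite condition, which can be decided.
-/
theorem starLift_halfTwist {c : UConf (n + 1)} (h : InGeneralPosition c) {q : Fin (n + 1) → ℂ}
    (hp : IsZigzag p 0) (hpc : range p = c.points) (hq : IsZigzag q 1)
    {τ τ' : Equiv.Perm (Fin (n + 1))} (hτ : ∀ a b, a < b → TwistCompatible τ i a b)
    (hτ' : τ' = Equiv.swap i.castSucc i.succ * τ) :
    StarLift q (halfTwist h i) (p ∘ τ) (p ∘ τ') := by
  have hs : sortedListing h = p := (sortedListing_spec h).unique ⟨hp.strictMono, hpc⟩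
  have := StarLift.of_forall (q := q) (g := halfTwist h i) (fun t => twistMotion p i t ∘ τ)
    (continuous_pi fun j => by simp only [Function.comp_apply, twistMotion]; split_ifs <;> fun_prop)
    (fun t => twistMotion_comp_mem_starOf hp hq hτ t.2.1 t.2.2)
    (fun t => by
      rw [τ.surjective.range_comp, ← hs]
      rfl)
  simp only [Icc.coe_zero, Icc.coe_one, twistMotion_zero, twistMotion_one] at this
  rw [hτ', Equiv.Perm.coe_mul]
  exact this

end Twist

/-! ### Rotations of a configuration -/

/-- The loop of configurations that rotates `c` counterclockwise through the angle `ψ`. -/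
noncomputable def rotationLoop {n : ℕ} (c : UConf n) (ψ : ℝ)
    (h : (fun z => Complex.exp (ψ * Complex.I) * z) '' c.points = c.points) : Path c c where
  toFun t := rotateClockwise n (-(t * ψ)) c
  continuous_toFun := by
    obtain ⟨p, rfl⟩ := UConf.exists_mk c
    refine UConf.continuous_mk.comp (Continuous.subtype_mk (continuous_pi fun i => ?_) _)
    fun_prop
  source' := UConf.points_injective (by simp [rotateClockwise_points])
  target' := UConf.points_injective (by
    rw [rotateClockwise_points]
    simpa using h)

theorem rotationLoop_points {n : ℕ} {c : UConf n} {ψ : ℝ}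
    (h : (fun z => Complex.exp (ψ * Complex.I) * z) '' c.points = c.points) (t : I) :
    (rotationLoop c ψ h t).points
      = (fun z => Complex.exp ((t : ℝ) * ψ * Complex.I) * z) '' c.points := by
  change (rotateClockwise n (-(t * ψ)) c).points = _
  rw [rotateClockwise_points]
  simp

theorem image_exp_two_mul {ψ : ℝ} {s : Set ℂ}
    (h : (fun z => Complex.exp (ψ * Complex.I) * z) '' s = s) :
    (fun z => Complex.exp ((2 * ψ : ℝ) * Complex.I) * z) '' s = s := by
  conv_rhs => rw [← h, ← h, image_image]
  refine image_congr fun z _ => ?_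
  rw [← mul_assoc, ← Complex.exp_add]
  push_cast
  ring_nf

/-- This is an equality of paths, not only a homotopy: both halves turn at the same speed, and the
angle ψ missing in the second half is a symmetry of the configuration. -/
theorem rotationLoop_trans_self {n : ℕ} {c : UConf n} {ψ : ℝ}
    (h : (fun z => Complex.exp (ψ * Complex.I) * z) '' c.points = c.points) :
    (rotationLoop c ψ h).trans (rotationLoop c ψ h)
      = rotationLoop c (2 * ψ) (image_exp_two_mul h) := by
  refine Path.ext (funext fun t => UConf.points_injective ?_)
  rw [Path.trans_apply, rotationLoop_points]
  split_ifs
  · rw [rotationLoop_points]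
    refine image_congr fun z _ => ?_
    push_cast
    ring_nf
  · rw [rotationLoop_points]
    conv_lhs => rw [← h, image_image]
    refine image_congr fun z _ => ?_
    rw [← mul_assoc, ← Complex.exp_add]
    push_cast
    ring_nf

/-! ### Regular hexagons -/

/-- The `k`-th vertex of the regular hexagon of radius `R` with first vertex at the angle `α`. -/
noncomputable def hexVertex (R α : ℝ) (k : ℕ) : ℂ :=
  R * Complex.exp ((α + k * (Real.pi / 3) : ℝ) * Complex.I)

theorem hexVertex_re (R α : ℝ) (k : ℕ) :
    (hexVertex R α k).re = R * Real.cos (α + k * (Real.pi / 3)) := by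
  rw [hexVertex, Complex.re_ofReal_mul, Complex.exp_ofReal_mul_I_re]

theorem hexVertex_im (R α : ℝ) (k : ℕ) :
    (hexVertex R α k).im = R * Real.sin (α + k * (Real.pi / 3)) := by
  rw [hexVertex, Complex.im_ofReal_mul, Complex.exp_ofReal_mul_I_im]

theorem exp_mul_hexVertex (R α β : ℝ) (k : ℕ) :
    Complex.exp (β * Complex.I) * hexVertex R α k = hexVertex R (α + β) k := by
  rw [hexVertex, hexVertex, mul_left_comm, ← Complex.exp_add]
  push_cast
  ring_nf

theorem hexVertex_add_pi_div_three (R α : ℝ) (k : ℕ) :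
    hexVertex R (α + Real.pi / 3) k = hexVertex R α (k + 1) := by
  rw [hexVertex, hexVertex]
  push_cast
  ring_nf

theorem hexVertex_add_six (R α : ℝ) (k : ℕ) : hexVertex R α (k + 6) = hexVertex R α k := by
  rw [hexVertex, hexVertex, show (α + ((k + 6 : ℕ) : ℝ) * (Real.pi / 3) : ℝ)
    = (α + k * (Real.pi / 3)) + 2 * Real.pi by push_cast; ring, Complex.ofReal_add, add_mul,
    Complex.exp_add]
  simp [Complex.exp_two_pi_mul_I]

theorem hexVertex_pow_six (R α : ℝ) (k : ℕ) : hexVertex R α k ^ 6 = hexVertex R α 0 ^ 6 := by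
  rw [hexVertex, hexVertex, mul_pow, mul_pow, ← Complex.exp_nat_mul, ← Complex.exp_nat_mul]
  congr 1
  refine Complex.exp_eq_exp_iff_exists_int.2 ⟨k, ?_⟩
  push_cast
  ring

theorem cos_two_mul_pi_div_three : Real.cos (2 * (Real.pi / 3)) = -1 / 2 := by
  rw [Real.cos_two_mul, Real.cos_pi_div_three]; norm_num

theorem sin_two_mul_pi_div_three : Real.sin (2 * (Real.pi / 3)) = √3 / 2 := by
  rw [Real.sin_two_mul, Real.cos_pi_div_three, Real.sin_pi_div_three]; ring

theorem trig_add_three_mul (α x : ℝ) :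
    Real.cos (α + (x + 3) * (Real.pi / 3)) = -Real.cos (α + x * (Real.pi / 3)) ∧
    Real.sin (α + (x + 3) * (Real.pi / 3)) = -Real.sin (α + x * (Real.pi / 3)) := by
  rw [← Real.cos_add_pi, ← Real.sin_add_pi]
  constructor <;> ring_nf

/-- The order of the vertices of a hexagon from left to right, when it is turned slightly
clockwise. -/
def orderBefore : Fin 6 → ℕ := ![3, 4, 2, 5, 1, 0]

/-- The order of the vertices of a hexagon from left to right, when it is turned slightly
counterclockwise. -/
def orderAfter : Fin 6 → ℕ := ![3, 2, 4, 1, 5, 0]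

section Hexagon

variable {R α : ℝ}

theorem hexVertex_coordinates (R α : ℝ) :
    (∀ k, (hexVertex R α (k + 3)).re = -(hexVertex R α k).re ∧
      (hexVertex R α (k + 3)).im = -(hexVertex R α k).im) ∧
    (hexVertex R α 0).re = R * Real.cos α ∧ (hexVertex R α 0).im = R * Real.sin α ∧
    (hexVertex R α 1).re = R * (Real.cos α / 2 - √3 * Real.sin α / 2) ∧
    (hexVertex R α 1).im = R * (Real.sin α / 2 + √3 * Real.cos α / 2) ∧
    (hexVertex R α 2).re = R * (-Real.cos α / 2 - √3 * Real.sin α / 2) ∧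
    (hexVertex R α 2).im = R * (-Real.sin α / 2 + √3 * Real.cos α / 2) := by
  refine ⟨fun k => ?_, ?_, ?_, ?_, ?_, ?_, ?_⟩
  · simp only [hexVertex_re, hexVertex_im]
    push_cast
    rw [(trig_add_three_mul α k).1, (trig_add_three_mul α k).2]
    constructor <;> ring
  · simp [hexVertex_re]
  · simp [hexVertex_im]
  · rw [hexVertex_re, Nat.cast_one, one_mul, Real.cos_add, Real.cos_pi_div_three,
      Real.sin_pi_div_three]
    ring
  · rw [hexVertex_im, Nat.cast_one, one_mul, Real.sin_add, Real.cos_pi_div_three,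
      Real.sin_pi_div_three]
    ring
  · rw [hexVertex_re, Nat.cast_two, Real.cos_add, cos_two_mul_pi_div_three,
      sin_two_mul_pi_div_three]
    ring
  · rw [hexVertex_im, Nat.cast_two, Real.sin_add, cos_two_mul_pi_div_three,
      sin_two_mul_pi_div_three]
    ring

/-- This is |tan α| < tan (π/6). At α = ±π/6 the hexagon has vertical sides, and real parts of
adjacent vertices coincide. -/
theorem sqrt_three_mul_sin_lt_cos (h : |α| < Real.pi / 6) :
    √3 * |Real.sin α| < Real.cos α := by
  have hpi := Real.pi_pos
  have h3 : √3 * √3 = 3 := Real.mul_self_sqrt (by norm_num)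
  have h3' : 0 < √3 := by positivity
  have hc : √3 / 2 < Real.cos α := by
    rw [← Real.cos_abs, ← Real.cos_pi_div_six]
    exact Real.cos_lt_cos_of_nonneg_of_le_pi_div_two (abs_nonneg _) (by linarith) h
  have hs : |Real.sin α| < 1 / 2 := by
    have h1 := abs_lt.1 h
    rw [abs_lt]
    constructor
    · rw [← Real.sin_pi_div_six, ← Real.sin_neg]
      exact Real.sin_lt_sin_of_lt_of_le_pi_div_two (by linarith) (by linarith) h1.1
    · rw [← Real.sin_pi_div_six]
      exact Real.sin_lt_sin_of_lt_of_le_pi_div_two (by linarith) (by linarith) h1.2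
  nlinarith

/-- Given the coordinates of the vertices, all the inequalities are linear in cos α, sin α, √3 cos
α, √3 sin α, and follow from positivity and √3 sin α < cos α. -/
theorem isZigzag_orderBefore (hR : 0 < R) (h0 : 0 < α) (h1 : α < Real.pi / 6) :
    IsZigzag (fun j => hexVertex R (-α) (orderBefore j)) 0 := by
  have hpi := Real.pi_pos
  obtain ⟨h3, r0, i0, r1, i1, r2, i2⟩ := hexVertex_coordinates R (-α)
  have hs : 0 < Real.sin α := Real.sin_pos_of_pos_of_lt_pi h0 (by linarith)
  have hc := sqrt_three_mul_sin_lt_cos (α := α) (by rwa [abs_of_pos h0])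
  rw [abs_of_pos hs] at hc
  rw [Real.sin_neg, Real.cos_neg] at *
  have hs3 : 0 < √3 * Real.sin α := by positivity
  have hc0 : 0 < Real.cos α := hs3.trans hc
  have hc3 : 0 < √3 * Real.cos α := by positivity
  have r3 := (h3 0).1
  have r4 := (h3 1).1
  have r5 := (h3 2).1
  have i3 := (h3 0).2
  have i4 := (h3 1).2
  have i5 := (h3 2).2
  norm_num at r3 r4 r5 i3 i4 i5
  refine ⟨Fin.strictMono_iff_lt_succ.2 fun k => ?_, fun k hk => ?_, fun k hk => ?_⟩
  · fin_cases k <;> simp [orderBefore, r0, r1, r2, r3, r4, r5, hR, ← mul_neg] <;> linarith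
  · fin_cases k <;> simp at hk <;> simp [orderBefore, i0, i1, i2, i3, i4, i5, hR, ← mul_neg] <;> linarith
  · fin_cases k <;> simp at hk <;> simp [orderBefore, i1, i2, i4, i5, hR, ← mul_neg] <;> linarith

theorem isZigzag_orderAfter (hR : 0 < R) (h0 : 0 < α) (h1 : α < Real.pi / 6) :
    IsZigzag (fun j => hexVertex R α (orderAfter j)) 1 := by
  have hpi := Real.pi_pos
  obtain ⟨h3, r0, i0, r1, i1, r2, i2⟩ := hexVertex_coordinates R α
  have hs : 0 < Real.sin α := Real.sin_pos_of_pos_of_lt_pi h0 (by linarith)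
  have hc := sqrt_three_mul_sin_lt_cos (α := α) (by rwa [abs_of_pos h0])
  rw [abs_of_pos hs] at hc
  have hs3 : 0 < √3 * Real.sin α := by positivity
  have hc0 : 0 < Real.cos α := hs3.trans hc
  have hc3 : 0 < √3 * Real.cos α := by positivity
  have r3 := (h3 0).1
  have r4 := (h3 1).1
  have r5 := (h3 2).1
  have i3 := (h3 0).2
  have i4 := (h3 1).2
  have i5 := (h3 2).2
  norm_num at r3 r4 r5 i3 i4 i5
  refine ⟨Fin.strictMono_iff_lt_succ.2 fun k => ?_, fun k hk => ?_, fun k hk => ?_⟩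
  · fin_cases k <;> simp [orderAfter, r0, r1, r2, r3, r4, r5, hR, ← mul_neg] <;> linarith
  · fin_cases k <;> simp at hk <;> simp [orderAfter, i1, i2, i4, i5, hR, ← mul_neg] <;> linarith
  · fin_cases k <;> simp at hk <;> simp [orderAfter, i0, i1, i2, i3, i4, i5, hR, ← mul_neg] <;> linarith

/-- Two numbers with the same nonzero sixth power differ by a power of e^(iπ/3). The list `f` only
has to meet every residue 0, …, 5, so one description serves for every ordering of the vertices. -/
theorem range_hexVertex (hR : R ≠ 0) (α : ℝ) {f : Fin 6 → ℕ} (hf : ∀ k < 6, ∃ j, f j = k) :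
    range (fun j => hexVertex R α (f j)) = {z | z ^ 6 = hexVertex R α 0 ^ 6} := by
  ext z
  constructor
  · rintro ⟨j, rfl⟩
    exact hexVertex_pow_six R α _
  · intro hz
    have h0 : hexVertex R α 0 ≠ 0 :=
      mul_ne_zero (Complex.ofReal_ne_zero.2 hR) (Complex.exp_ne_zero _)
    have hz1 : (z / hexVertex R α 0) ^ 6 = 1 := by
      rw [div_pow, show z ^ 6 = _ from hz, div_self (pow_ne_zero _ h0)]
    obtain ⟨k, hk, hk'⟩ :=
      (Complex.isPrimitiveRoot_exp 6 (by norm_num)).eq_pow_of_pow_eq_one hz1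
    obtain ⟨j, rfl⟩ := hf k hk
    refine ⟨j, ?_⟩
    rw [eq_div_iff h0, ← Complex.exp_nat_mul] at hk'
    simp only
    rw [← hk', hexVertex, hexVertex, mul_left_comm, ← Complex.exp_add]
    push_cast
    ring_nf

end Hexagon

/-! ### The rotation of a hexagon as a product of Artin generators -/

/-- Rotating a regular hexagon through the angle `π / 3` is the braid `σ₂ σ₄ σ₁ σ₃ σ₅`. -/
theorem loopClass_rotationLoop_hexagon {c : UConf 6} (h : InGeneralPosition c) {R θ : ℝ}
    (hR : 0 < R) (hθ : 0 < θ) (hθ' : θ < Real.pi / 6)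
    (hc : range (fun j => hexVertex R (-θ) (orderBefore j)) = c.points)
    (hrot : (fun z => Complex.exp ((Real.pi / 3 : ℝ) * Complex.I) * z) '' c.points = c.points) :
    loopClass (rotationLoop c (Real.pi / 3) hrot) = artinGenerator h 1 * artinGenerator h 3 *
      artinGenerator h 0 * artinGenerator h 2 * artinGenerator h 4 := by
  have hpi := Real.pi_pos
  have hp := isZigzag_orderBefore hR hθ hθ'
  -- The angle π/12 is the centre of the interval (-π/6, π/3) that contains all angles from -θ to -θ
  -- + π/3, and lies in (0, π/6), as the opposite zigzag requires.
  have hq := isZigzag_orderAfter (α := Real.pi / 12) hR (by linarith) (by linarith)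
  set p : Fin 6 → ℂ := fun j => hexVertex R (-θ) (orderBefore j) with hpdef
  set q : Fin 6 → ℂ := fun j => hexVertex R (Real.pi / 12) (orderAfter j) with hqdef
  have hqinj : Function.Injective q := fun i j hij =>
    hq.strictMono.injective (congrArg Complex.re hij)
  -- The inversions of the labels go from {12, 34} to {34}, to none, then to {01}, {01, 23} and {01,
  -- 23, 45}.
  have hbraid := ((((starLift_halfTwist (i := 1) (τ := Equiv.swap 1 2 * Equiv.swap 3 4)
      (τ' := Equiv.swap 3 4) h hp hc hq (by decide) (by decide)).trans
    (starLift_halfTwist (i := 3) (τ' := 1) h hp hc hq (by decide) (by decide))).trans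
    (starLift_halfTwist (i := 0) (τ' := Equiv.swap 0 1) h hp hc hq (by decide) (by decide))).trans
    (starLift_halfTwist (i := 2) (τ' := Equiv.swap 0 1 * Equiv.swap 2 3) h hp hc hq
      (by decide) (by decide))).trans
    (starLift_halfTwist (i := 4) (τ' := Equiv.swap 0 1 * Equiv.swap 2 3 * Equiv.swap 4 5)
      h hp hc hq (by decide) (by decide))
  have hbefore : ∀ j, orderBefore ((Equiv.swap 1 2 * Equiv.swap 3 4 : Equiv.Perm (Fin 6)) j)
      = orderAfter j := by decide
  have hrotation := StarLift.of_forall (q := q) (g := rotationLoop c (Real.pi / 3) hrot)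
    (fun t j => hexVertex R (-θ + (t : ℝ) * (Real.pi / 3)) (orderAfter j))
    (by unfold hexVertex; fun_prop)
    -- A rotated copy of `q`: all quotients of differences equal the same unit number, whose
    -- argument lies in (-π/4, π/4).
    (fun t i j hij => by
      have hβ : ∀ k, hexVertex R (-θ + (t : ℝ) * (Real.pi / 3)) k
          = Complex.exp ((-θ + (t : ℝ) * (Real.pi / 3) - Real.pi / 12 : ℝ) * Complex.I)
            * hexVertex R (Real.pi / 12) k := by
        intro k
        rw [exp_mul_hexVertex]
        ring_nf
      change (hexVertex R _ _ - hexVertex R _ _) / (q i - q j) ∈ _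
      rw [hβ, hβ, ← mul_sub, mul_div_cancel_right₀ _ (sub_ne_zero.2 (hqinj.ne hij)),
        Complex.mem_slitPlane_iff]
      left
      rw [Complex.exp_ofReal_mul_I_re]
      have ht0 := t.2.1
      have ht1 := t.2.2
      exact Real.cos_pos_of_mem_Ioo ⟨by nlinarith, by nlinarith⟩)
    (fun t => by
      rw [rotationLoop_points, ← hc, ← range_comp,
        ← (Equiv.swap 1 2 * Equiv.swap 3 4 : Equiv.Perm (Fin 6)).surjective.range_comp]
      congr 1
      funext j
      have := exp_mul_hexVertex R (-θ) ((t : ℝ) * (Real.pi / 3)) (orderAfter j)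
      simp only [hpdef, Function.comp_apply, hbefore, ← this]
      push_cast
      rfl)
  have h0 : (fun j => hexVertex R (-θ + ((0 : I) : ℝ) * (Real.pi / 3)) (orderAfter j))
      = p ∘ (Equiv.swap 1 2 * Equiv.swap 3 4 : Equiv.Perm (Fin 6)) := by
    funext j
    simp only [hpdef, Function.comp_apply, hbefore, Icc.coe_zero, zero_mul, add_zero]
  have h1 : (fun j => hexVertex R (-θ + ((1 : I) : ℝ) * (Real.pi / 3)) (orderAfter j))
      = p ∘ (Equiv.swap 0 1 * Equiv.swap 2 3 * Equiv.swap 4 5 : Equiv.Perm (Fin 6)) := by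
    -- The turn through π/3 raises every vertex number by one; the second alternative is the
    -- wrap-around of vertex 5 to 6, which is vertex 0.
    have hafter : ∀ j, orderAfter j + 1 = orderBefore ((Equiv.swap 0 1 * Equiv.swap 2 3 *
        Equiv.swap 4 5 : Equiv.Perm (Fin 6)) j) ∨ orderAfter j + 1 = orderBefore ((Equiv.swap 0 1 *
        Equiv.swap 2 3 * Equiv.swap 4 5 : Equiv.Perm (Fin 6)) j) + 6 := by decide
    funext j
    simp only [hpdef, Function.comp_apply, Icc.coe_one, one_mul]
    rw [hexVertex_add_pi_div_three]
    rcases hafter j with hj | hj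
    · rw [hj]
    · rw [hj, hexVertex_add_six]
  rw [h0, h1] at hrotation
  exact loopClass_eq_of_homotopic (hrotation.homotopic hqinj hbraid)

/-! ### The braid monodromy of the curve `(y³ + x²)(y³ - x²) = 0` -/

theorem curveFiber_twoCusps (x : ℂ) : curveFiber twoCusps x = {y | y ^ 6 = x ^ 4} := by
  ext y
  have : (twoCusps.map (evalRingHom x)).eval y = y ^ 6 - x ^ 4 := by
    simp [twoCusps]
    ring
  change (twoCusps.map (evalRingHom x)).eval y = 0 ↔ y ^ 6 = x ^ 4
  rw [this, sub_eq_zero]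

theorem zero_mem_criticalSet_twoCusps : (0 : ℂ) ∈ criticalSet twoCusps 6 := by
  have : curveFiber twoCusps 0 = {0} := by
    rw [curveFiber_twoCusps]
    ext y
    simp
  change (curveFiber twoCusps 0).encard ≠ 6
  rw [this, encard_singleton]
  norm_num

theorem image_mul_setOf_pow_eq {u : ℂ} (hu : u ≠ 0) (n : ℕ) (w : ℂ) :
    (fun z => u * z) '' {y | y ^ n = w} = {z | z ^ n = u ^ n * w} := by
  ext z
  constructor
  · rintro ⟨y, rfl, rfl⟩
    exact mul_pow u y n
  · intro hz
    refine ⟨z / u, ?_, mul_div_cancel₀ z hu⟩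
    change (z / u) ^ n = w
    rw [div_pow, show z ^ n = _ from hz, mul_div_cancel_left₀ _ (pow_ne_zero n hu)]

theorem exists_pow_six_eq_pow_four {r : ℝ} (hr : 0 < r) : ∃ R : ℝ, 0 < R ∧ R ^ 6 = r ^ 4 := by
  refine ⟨r ^ (2 / 3 : ℝ), Real.rpow_pos_of_pos hr _, ?_⟩
  rw [← Real.rpow_natCast, ← Real.rpow_mul hr.le, ← Real.rpow_natCast]
  norm_num

theorem mainTheorem8 (r : ℝ) (hr : 0 < r) (θ : ℝ) (hθ : 0 < θ) (hθ' : θ < Real.pi / 6) :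
    let E : Set ℂ := Metric.closedBall 0 r
    let hE : E ∩ criticalSet twoCusps 6 ⊆ {0} := twoCusps_criticalSet_subset E
    let M : ↥(E \ criticalSet twoCusps 6) := boundaryPoint hr hE
    let Γ : LoopGroup ↥(E \ criticalSet twoCusps 6) M := loopClass (boundaryLoop hr hE)
    let K : UConf 6 := fiberConf twoCusps twoCusps_natDegree E M
    let φ : LoopGroup ↥(E \ criticalSet twoCusps 6) M →* BraidGroup K :=
      braidMonodromy twoCusps twoCusps_natDegree E M
    let ρ : BraidGroup K →* BraidGroup (rotateClockwise 6 θ K) := loopMap (rotateClockwise 6 θ) K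
    ∃ h : InGeneralPosition (rotateClockwise 6 θ K),
      let σ₁ := artinGenerator h 0
      let σ₂ := artinGenerator h 1
      let σ₃ := artinGenerator h 2
      let σ₄ := artinGenerator h 3
      let σ₅ := artinGenerator h 4
      ρ (φ Γ) = (σ₂ * σ₄ * σ₁ * σ₃ * σ₅) ^ 4 ∧
        (ρ.comp φ).range = Subgroup.zpowers ((σ₂ * σ₄ * σ₁ * σ₃ * σ₅) ^ 4) := by
  intro E hE M Γ K φ ρ
  obtain ⟨R, hR, hRr⟩ := exists_pow_six_eq_pow_four hr
  have hRr' : (R : ℂ) ^ 6 = (r : ℂ) ^ 4 := by exact_mod_cast hRr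
  let c := rotateClockwise 6 θ K
  have hfib : ∀ x, (fiberConf twoCusps twoCusps_natDegree E x).points
      = {y | y ^ 6 = (x : ℂ) ^ 4} := fun x =>
    (points_fiberConfFun twoCusps 6 E x).trans (curveFiber_twoCusps x)
  -- The configuration is described by a single sixth power, so that symmetries and equalities of
  -- configurations become identities between sixth powers.
  have hcpow : c.points = {z | z ^ 6 = hexVertex R (-θ) 0 ^ 6} := by
    rw [rotateClockwise_points, hfib, image_mul_setOf_pow_eq (Complex.exp_ne_zero _)]
    simp only [M, boundaryPoint, hexVertex, zero_add, mul_pow, hRr']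
    simp [mul_comm]
  have hc : range (fun j => hexVertex R (-θ) (orderBefore j)) = c.points := by
    rw [hcpow, range_hexVertex hR.ne' _ (by decide)]
  have hrot : (fun z => Complex.exp ((Real.pi / 3 : ℝ) * Complex.I) * z) '' c.points
      = c.points := by
    rw [hcpow, image_mul_setOf_pow_eq (Complex.exp_ne_zero _), ← mul_pow, exp_mul_hexVertex,
      hexVertex_add_pi_div_three, hexVertex_pow_six]
  have hp := isZigzag_orderBefore hR hθ hθ'
  have hgen : InGeneralPosition c := by
    rw [InGeneralPosition, ← hc]
    rintro _ ⟨i, rfl⟩ _ ⟨j, rfl⟩ hij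
    rw [hp.strictMono.injective hij]
  refine ⟨hgen, ?_⟩
  have hmon : ρ (φ Γ) = (artinGenerator hgen 1 * artinGenerator hgen 3 * artinGenerator hgen 0 *
      artinGenerator hgen 2 * artinGenerator hgen 4) ^ 4 := by
    -- The fourth power is bracketed as a square of a square: two doublings give the rotation
    -- through 4π/3 at constant speed, which is the monodromy loop itself, with no homotopy needed.
    rw [← loopClass_rotationLoop_hexagon hgen hR hθ hθ' hc hrot,
      show (4 : ℕ) = 2 + 2 from rfl, pow_add, pow_two, loopClass_mul, loopClass_mul,
      rotationLoop_trans_self, rotationLoop_trans_self]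
    change loopClass (((boundaryLoop hr hE).map
      (fiberConf twoCusps twoCusps_natDegree E).continuous).map
        (rotateClockwise 6 θ).continuous) = _
    congr 1
    refine Path.ext (funext fun t => UConf.points_injective ?_)
    rw [rotationLoop_points]
    change (rotateClockwise 6 θ (fiberConf twoCusps twoCusps_natDegree E
      (boundaryLoop hr hE t))).points = _
    rw [rotateClockwise_points, hfib, hcpow, image_mul_setOf_pow_eq (Complex.exp_ne_zero _),
      image_mul_setOf_pow_eq (Complex.exp_ne_zero _)]
    -- Both exponents are 8πit: four turns of x in x⁴, and six times the angle 4πt/3 of the hexagon.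
    have hx : ((boundaryLoop hr hE t : ℂ)) ^ 4
        = R ^ 6 * Complex.exp ((t : ℝ) * (2 * (2 * (Real.pi / 3)) : ℝ) * Complex.I) ^ 6 := by
      change (0 + r * Complex.exp (2 * Real.pi * Complex.I * (t : ℝ))) ^ 4 = _
      rw [zero_add, mul_pow, hRr', ← Complex.exp_nat_mul, ← Complex.exp_nat_mul]
      push_cast
      ring_nf
    have hv : hexVertex R (-θ) 0 = R * Complex.exp (-(θ * Complex.I)) := by
      simp [hexVertex]
    rw [hx, hv]
    ext z
    change z ^ 6 = _ ↔ z ^ 6 = _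
    rw [mul_pow]
    ring_nf
  refine ⟨hmon, ?_⟩
  -- The whole fundamental group is cyclic on the boundary circle, so the image is cyclic on its
  -- braid.
  rw [← hmon, MonoidHom.range_eq_map,
    ← zpowers_loopClass_boundaryLoop hr hE zero_mem_criticalSet_twoCusps, MonoidHom.map_zpowers]
  rfl
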